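/- \textbf{Theorem.} Let $\mathcal{H}=\mathcal{H}_A\otimes\mathcal{H}_B$ with $\mathcal{H}_A,\mathcal{H}_B$ finite-dimensional. For every entangled state $\rho\in\mathcal{D}(\mathcal{H})$ and every integer $k\ge 1$ there is a copy-correlated $k$-undistillable state $\sigma$ on some finite-dimensional bipartite space $\mathcal{K}=\mathcal{K}_A\otimes\mathcal{K}_B$ such that the joint state $\rho\otimes\sigma$, regarded as a bipartite state on $(\mathcal{H}_A\otimes\mathcal{K}_A)\otimes(\mathcal{H}_B\otimes\mathcal{K}_B)$, is single-copy distillable, i.e. $$F_2(\rho\otimes\sigma)>\tfrac12 .$$ Here a state is entangled if it is not a finite convex combination $\sum_i p_i\,\rho_i^A\otimes\rho_i^B$ of product states, and the singlet fraction of a bipartite state $\omega$ is $$F_2(\omega)=\sup_{\Omega}\frac{\operatorname{tr}(\Omega(\omega)\Phi(2))}{\operatorname{tr}(\Omega(\omega))},\qquad \Phi(2)=\frac12\sum_{i,j=1}^{2}|i,i\rangle\langle j,j|,$$ the supremum being over all SLOCC maps $\Omega$ into operators on $\mathbb{C}^2\otimes\mathbb{C}^2$ with $\operatorname{tr}(\Omega(\omega))>0$;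 SLOCC maps are the maps $\Omega(X)=\sum_{l}(A_l\otimes B_l)X(A_l\otimes B_l)^\dagger$ (finite sums, with local operators $A_l,B_l$) such that $\sum_l A_l^\dagger A_l\otimes B_l^\dagger B_l\le\mathbb{I}$. A state $\sigma$ on $\mathcal{K}$ is copy-correlated $k$-undistillable if there is a state $\omega$ on $\mathcal{K}^{\otimes k}$, regarded as bipartite with respect to $\mathcal{K}_A^{\otimes k}\otimes\mathcal{K}_B^{\otimes k}$, that is invariant under all permutations of the $k$ copies ($P_\pi\,\omega\,P_\pi^\dagger=\omega$ for all $\pi\in S_k$), has $\sigma$ as its reduced state on each copy, and is single-copy undistillable, i.e. $F_2(\omega)=\tfrac12$. -/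

import Mathlib

open scoped ComplexOrder Kronecker Matrix

namespace CopyCorrelated

/-- Operators on `ℋ_A ⊗ ℋ_B`, where the finite types `a` and `b` index orthonormal bases of
`ℋ_A` and `ℋ_B`. -/
abbrev BipartiteOp (a b : Type*) := Matrix (a × b) (a × b) ℂ

/-- Density matrices. -/
def IsState {n : Type*} [Fintype n] (ρ : Matrix n n ℂ) : Prop :=
  ρ.PosSemidef ∧ ρ.trace = 1

/-- Separable (non-entangled) states: finite convex combinations of product states. -/
def IsSeparable {a b : Type*} [Fintype a] [Fintype b] (ρ : BipartiteOp a b) : Prop :=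
  ∃ (r : ℕ) (p : Fin r → ℝ) (α : Fin r → Matrix a a ℂ) (β : Fin r → Matrix b b ℂ),
    (∀ i, 0 ≤ p i) ∧ ∑ i, p i = 1 ∧ (∀ i, IsState (α i)) ∧ (∀ i, IsState (β i)) ∧
      ρ = ∑ i, (p i : ℂ) • (α i ⊗ₖ β i)

/-- Entangled states: the states that are not separable. -/
def IsEntangled {a b : Type*} [Fintype a] [Fintype b] (ρ : BipartiteOp a b) : Prop :=
  IsState ρ ∧ ¬ IsSeparable ρ

/-- SLOCC maps: `Ω(X) = ∑ₖ (Aₖ ⊗ Bₖ) X (Aₖ ⊗ Bₖ)†` with local operators `Aₖ`, `Bₖ` such that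
`∑ₖ Aₖ† Aₖ ⊗ Bₖ† Bₖ ≤ 𝕀`. -/
def IsSLOCC {a b c d : Type*} [Fintype a] [DecidableEq a] [Fintype b] [DecidableEq b]
    [Fintype c] [Fintype d] (Ω : BipartiteOp a b →ₗ[ℂ] BipartiteOp c d) : Prop :=
  ∃ (r : ℕ) (A : Fin r → Matrix c a ℂ) (B : Fin r → Matrix d b ℂ),
    (1 - ∑ i, ((A i)ᴴ * A i) ⊗ₖ ((B i)ᴴ * B i)).PosSemidef ∧
      ∀ X, Ω X = ∑ i, (A i ⊗ₖ B i) * X * (A i ⊗ₖ B i)ᴴ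

/-- The maximally entangled state `Φ(K) = (1/K) ∑ᵢ ∑ⱼ |i,i⟩⟨j,j|`. -/
noncomputable def maxEntangled (K : ℕ) : BipartiteOp (Fin K) (Fin K) :=
  Matrix.of fun p q => if p.1 = p.2 ∧ q.1 = q.2 then (1 / K : ℂ) else 0

/-- The singlet fraction `F_K(ρ) = sup_Ω tr(Ω(ρ) Φ(K)) / tr(Ω(ρ))`, the supremum being over all
SLOCC maps `Ω` into operators on `ℂ^K ⊗ ℂ^K` that succeed on `ρ` with nonzero probability. -/
noncomputable def singletFraction {a b : Type*} [Fintype a] [DecidableEq a] [Fintype b]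
    [DecidableEq b] (K : ℕ) (ρ : BipartiteOp a b) : ℝ :=
  sSup {x : ℝ | ∃ Ω : BipartiteOp a b →ₗ[ℂ] BipartiteOp (Fin K) (Fin K),
    IsSLOCC Ω ∧ 0 < (Ω ρ).trace.re ∧
      x = (Ω ρ * maxEntangled K).trace.re / (Ω ρ).trace.re}

/-- The tensor product of two bipartite operators, as a bipartite operator
(Alice holds both `A` parts, Bob both `B` parts). -/
def tensor {a b c d : Type*} (ρ : BipartiteOp a b) (σ : BipartiteOp c d) :
    BipartiteOp (a × c) (b × d) :=
  (ρ ⊗ₖ σ).submatrix (Equiv.prodProdProdComm a c b d) (Equiv.prodProdProdComm a c b d)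

/-- Operators on `k` copies of `ℋ_A ⊗ ℋ_B`, as bipartite operators
(Alice holds all `A` parts, Bob all `B` parts). -/
abbrev CopiesOp (k : ℕ) (a b : Type*) := BipartiteOp (Fin k → a) (Fin k → b)

/-- Invariance under every permutation of the `k` copies: `P_π ω P_π† = ω`. -/
def IsPermSymmetric {k : ℕ} {a b : Type*} (ω : CopiesOp k a b) : Prop :=
  ∀ π : Equiv.Perm (Fin k),
    ω.submatrix (fun s => (s.1 ∘ π, s.2 ∘ π)) (fun s => (s.1 ∘ π, s.2 ∘ π)) = ω

/-- The reduction `tr_{∖ m}(ω)` to the `m`-th copy, all other copies being traced out. -/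
def marginal {k : ℕ} {a b : Type*} [Fintype a] [DecidableEq a] [Fintype b] [DecidableEq b]
    (m : Fin k) (ω : CopiesOp k a b) : BipartiteOp a b :=
  Matrix.of fun p q => ∑ s : Fin k → a, ∑ t : Fin k → b,
    if s m = p.1 ∧ t m = p.2 then ω (s, t) (Function.update s m q.1, Function.update t m q.2)
    else 0

/-- `ρ` is copy-correlated `k`-undistillable: it has a permutation-symmetric extension `ω` to
`k` copies, a state all of whose one-copy reductions are `ρ`, that is single-copy undistillable,
`F₂(ω) = 1/2`. (By symmetry, the reductions of `ω` to the single copies all agree.) -/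
def IsCopyCorrelatedUndistillable {a b : Type*} [Fintype a] [DecidableEq a] [Fintype b]
    [DecidableEq b] (k : ℕ) (ρ : BipartiteOp a b) : Prop :=
  IsState ρ ∧ ∃ ω : CopiesOp k a b, IsState ω ∧ IsPermSymmetric ω ∧
    singletFraction 2 ω = 1 / 2 ∧ ∀ m : Fin k, marginal m ω = ρ

end CopyCorrelated

namespace CopyCorrelated

/-! The separable states form a compact convex set, so an entangled `ρ` is strictly separated from
them by a Hermitian witness `W`, positive on all product vectors and negative on `ρ`
(`exists_entanglement_witness`). The activator is `τ = t 𝕀 ⊗ (𝕀 + 2Φ(2)) + W ⊗ (𝕀 - 2Φ(2))`, with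
one extra qubit on each side.

Why `τ` is undistillable for large `t`: the partial transpose of `2Φ(2)` is the swap, so that of `τ`
is `2t` times the symmetric qubit projection plus `W^Γ` tensored with twice the antisymmetric one. A
local map into two qubits tests this operator on a vector `u` of Schmidt rank at most 2
(`excess_local_eq`). Where the first term vanishes, `u` is `v ⊗ singlet`; its rank is twice that of
`v`, so `v` is a product vector and the witness term is strictly positive
(`partialTransposeForm_witnessPart_pos`). Compactness then provides one `t` for all `u`
(`exists_activator_undistillable`).

Why `τ` activates `ρ`: contracting `ρ` with the `ℋ`-part of `τ` leaves two qubits. The `t`-term has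
excess 0 and the other has `-4` times the negative pairing of `W` with `ρ`
(`excess_contraction_activator`).

To reach `k` copies, put the normalized `τ` at a uniformly random copy and a fixed product basis
state at all others. This is symmetric, and undistillable because nonpositive excess survives sums
and local isometries. Its marginal is `τ` diluted by that product state, which contributes no excess
to the contraction (`isCopyCorrelatedUndistillable_mix`, `excess_contraction_single`). -/

/-- In finite dimension the convex hull of a compact set is compact (by Carathéodory). -/
theorem isCompact_convexHull_of_isCompact {E : Type*} [AddCommGroup E] [Module ℝ E]
    [TopologicalSpace E] [ContinuousAdd E] [ContinuousSMul ℝ E] [FiniteDimensional ℝ E] {s : Set E}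
    (hs : IsCompact s) : IsCompact (convexHull ℝ s) := by
  rcases s.eq_empty_or_nonempty with rfl | ⟨x₀, hx₀⟩
  · simp
  set N := Module.finrank ℝ E + 1 with hN
  have hK : IsCompact ((stdSimplex ℝ (Fin N)) ×ˢ (Set.univ.pi fun _ : Fin N => s)) :=
    (isCompact_stdSimplex ℝ (Fin N)).prod (isCompact_univ_pi fun _ => hs)
  have hcont : Continuous fun q : (Fin N → ℝ) × (Fin N → E) => ∑ i, q.1 i • q.2 i := by fun_prop
  convert hK.image hcont using 1
  ext x
  constructor
  · intro hx
    obtain ⟨ι, _, z, w, hz, haff, hw, hw1, hsum⟩ := eq_pos_convex_span_of_mem_convexHull hx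
    have hcard : Fintype.card ι ≤ Fintype.card (Fin N) := by
      simpa [hN] using haff.card_le_finrank_succ.trans
        (Nat.succ_le_succ (Submodule.finrank_le _))
    obtain ⟨e⟩ := Function.Embedding.nonempty_of_card_le hcard
    -- Carathéodory may use fewer than `N` points; the free slots get weight 0 and the dummy point
    -- `x₀`.
    refine ⟨(Function.extend e w 0, Function.extend e z fun _ => x₀), ⟨⟨?_, ?_⟩, ?_⟩, ?_⟩
    · intro i
      by_cases hi : ∃ j, e j = i
      · obtain ⟨j, rfl⟩ := hi
        simpa [e.injective.extend_apply] using (hw j).le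
      · simp [Function.extend_apply' _ _ _ hi]
    · rw [← hw1]
      symm
      refine Fintype.sum_of_injective e e.injective _ _ (fun i hi => ?_) fun j => ?_
      · exact Function.extend_apply' _ _ _ hi
      · simp [e.injective.extend_apply]
    · intro i _
      by_cases hi : ∃ j, e j = i
      · obtain ⟨j, rfl⟩ := hi
        simpa [e.injective.extend_apply] using hz ⟨j, rfl⟩
      · simpa [Function.extend_apply' _ _ _ hi] using hx₀
    · rw [← hsum]
      symm
      refine Fintype.sum_of_injective e e.injective _ _ (fun i hi => ?_) fun j => ?_
      · have : Function.extend e w 0 i = 0 := Function.extend_apply' _ _ _ hi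
        simp [this]
      · simp [e.injective.extend_apply]
  · rintro ⟨q, ⟨hq1, hq2⟩, rfl⟩
    exact (convex_convexHull ℝ s).sum_mem (fun i _ => hq1.1 i) hq1.2
      fun i _ => subset_convexHull ℝ s (hq2 i trivial)

/-! ### Entanglement witnesses by strict separation. -/

section Witness

variable {a b : Type*} [Fintype a] [Fintype b]

/-- The product pure operator `|α⟩⟨α| ⊗ |β⟩⟨β|`. -/
def productPure (α : a → ℂ) (β : b → ℂ) : BipartiteOp a b :=
  Matrix.vecMulVec α (star α) ⊗ₖ Matrix.vecMulVec β (star β)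

theorem isState_vecMulVec {α : a → ℂ} (h : ∑ i, ‖α i‖ ^ 2 = 1) :
    IsState (Matrix.vecMulVec α (star α)) := by
  refine ⟨Matrix.posSemidef_vecMulVec_self_star α, ?_⟩
  simp only [Matrix.trace, Matrix.diag_apply, Matrix.vecMulVec_apply, Pi.star_apply,
    RCLike.star_def, Complex.mul_conj']
  exact_mod_cast h

theorem isCompact_normalized (n : Type*) [Fintype n] :
    IsCompact {α : n → ℂ | ∑ i, ‖α i‖ ^ 2 = 1} := by
  refine Metric.isCompact_of_isClosed_isBounded
    (isClosed_eq (by fun_prop) continuous_const) ?_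
  refine Metric.isBounded_closedBall.subset (fun α (hα : ∑ i, ‖α i‖ ^ 2 = 1) => ?_)
    (t := Metric.closedBall 0 1)
  rw [mem_closedBall_zero_iff, pi_norm_le_iff_of_nonneg zero_le_one]
  intro i
  have := Finset.single_le_sum (f := fun i => ‖α i‖ ^ 2) (fun i _ => sq_nonneg _)
    (Finset.mem_univ i)
  simp only [hα] at this
  nlinarith [norm_nonneg (α i)]

/-- The product pure states. -/
def productPureStates (a b : Type*) [Fintype a] [Fintype b] : Set (BipartiteOp a b) :=
  (fun q : (a → ℂ) × (b → ℂ) => productPure q.1 q.2) ''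
    ({α | ∑ i, ‖α i‖ ^ 2 = 1} ×ˢ {β | ∑ i, ‖β i‖ ^ 2 = 1})

theorem isCompact_productPureStates : IsCompact (productPureStates a b) := by
  refine ((isCompact_normalized a).prod (isCompact_normalized b)).image ?_
  refine continuous_pi fun p => continuous_pi fun q => ?_
  simp only [productPure, Matrix.kroneckerMap_apply, Matrix.vecMulVec_apply, Pi.star_apply]
  fun_prop

theorem isSeparable_of_mem_convexHull {ρ : BipartiteOp a b}
    (h : ρ ∈ convexHull ℝ (productPureStates a b)) : IsSeparable ρ := by
  obtain ⟨ι, _, w, z, hw0, hw1, hz, rfl⟩ := mem_convexHull_iff_exists_fintype.1 h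
  choose q hq hqz using hz
  let e := (Fintype.equivFin ι).symm
  refine ⟨Fintype.card ι, fun i => w (e i),
    fun i => Matrix.vecMulVec (q (e i)).1 (star (q (e i)).1),
    fun i => Matrix.vecMulVec (q (e i)).2 (star (q (e i)).2), fun i => hw0 _, ?_,
    fun i => isState_vecMulVec (hq _).1, fun i => isState_vecMulVec (hq _).2, ?_⟩
  · rw [← hw1]
    exact Equiv.sum_comp e w
  · rw [← Equiv.sum_comp e]
    refine Finset.sum_congr rfl fun i _ => ?_
    rw [← hqz (e i)]
    simp [productPure]

theorem productPure_posSemidef (α : a → ℂ) (β : b → ℂ) : (productPure α β).PosSemidef :=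
  (Matrix.posSemidef_vecMulVec_self_star α).kronecker (Matrix.posSemidef_vecMulVec_self_star β)

theorem trace_productPure {α : a → ℂ} {β : b → ℂ} (hα : ∑ i, ‖α i‖ ^ 2 = 1)
    (hβ : ∑ i, ‖β i‖ ^ 2 = 1) : (productPure α β).trace = 1 := by
  rw [productPure, Matrix.trace_kronecker, (isState_vecMulVec hα).2, (isState_vecMulVec hβ).2,
    one_mul]

/-- The pairing of two matrices with the Hermitian part of the first. -/
theorem re_sum_hermitianPart {n : Type*} [Fintype n] (W X : Matrix n n ℂ) (hX : X.IsHermitian) :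
    (∑ p, ∑ q, ((1 / 2 : ℂ) • (W + Wᴴ)) p q * X p q).re = (∑ p, ∑ q, W p q * X p q).re := by
  have h1 : (∑ p, ∑ q, Wᴴ p q * X p q) = star (∑ p, ∑ q, W p q * X p q) := by
    rw [Finset.sum_comm, star_sum]
    refine Finset.sum_congr rfl fun p _ => ?_
    rw [star_sum]
    refine Finset.sum_congr rfl fun q _ => ?_
    rw [star_mul', Matrix.conjTranspose_apply, hX.apply]
  have h2 : (∑ p, ∑ q, ((1 / 2 : ℂ) • (W + Wᴴ)) p q * X p q) =
      (1 / 2 : ℂ) * (∑ p, ∑ q, W p q * X p q + ∑ p, ∑ q, Wᴴ p q * X p q) := by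
    simp only [Matrix.smul_apply, Matrix.add_apply, smul_eq_mul, mul_add, add_mul, mul_assoc,
      Finset.sum_add_distrib, Finset.mul_sum]
  rw [h2, h1]
  simp
  ring

theorem exists_smul_normalized {n : Type*} [Fintype n] {α : n → ℂ} (hα : α ≠ 0) :
    ∃ c : ℝ, 0 < c ∧ ∑ i, ‖((c : ℂ) • α) i‖ ^ 2 = 1 := by
  obtain ⟨i, hi⟩ := Function.ne_iff.1 hα
  have hpos : 0 < ∑ i, ‖α i‖ ^ 2 :=
    Finset.sum_pos' (fun i _ => sq_nonneg _)
      ⟨i, Finset.mem_univ i, pow_pos (norm_pos_iff.2 hi) 2⟩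
  refine ⟨(√(∑ i, ‖α i‖ ^ 2))⁻¹, inv_pos.2 (Real.sqrt_pos.2 hpos), ?_⟩
  simp only [Pi.smul_apply, smul_eq_mul, norm_mul, mul_pow, ← Finset.mul_sum, Complex.norm_real,
    Real.norm_eq_abs, sq_abs, inv_pow]
  rw [Real.sq_sqrt hpos.le, inv_mul_cancel₀ hpos.ne']

theorem productPure_smul {a b : Type*} (c d : ℝ) (α : a → ℂ) (β : b → ℂ) (p q : a × b) :
    productPure ((c : ℂ) • α) ((d : ℂ) • β) p q =
      ((c ^ 2 * d ^ 2 : ℝ) : ℂ) * productPure α β p q := by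
  simp only [productPure, Matrix.kroneckerMap_apply, Matrix.vecMulVec_apply, Pi.star_apply,
    Pi.smul_apply, smul_eq_mul, star_mul', RCLike.star_def, Complex.conj_ofReal]
  push_cast
  ring

/-- An entangled state is detected by a Hermitian entanglement witness that is strictly positive on
product vectors. -/
theorem exists_entanglement_witness {ρ : BipartiteOp a b} (hρ : IsEntangled ρ) :
    ∃ W : BipartiteOp a b, W.IsHermitian ∧ (∑ p, ∑ q, W p q * ρ p q).re < 0 ∧
      ∀ (α : a → ℂ) (β : b → ℂ), α ≠ 0 → β ≠ 0 →
        0 < (∑ p, ∑ q, W p q * productPure α β p q).re := by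
  classical
  let S : Set (a × b → a × b → ℂ) := convexHull ℝ (productPureStates a b)
  have hS : IsCompact S :=
    isCompact_convexHull_of_isCompact (E := a × b → a × b → ℂ) isCompact_productPureStates
  obtain ⟨f, u, hf1, hf2⟩ := RCLike.geometric_hahn_banach_point_closed (𝕜 := ℂ)
    (E := a × b → a × b → ℂ) (x := (ρ : a × b → a × b → ℂ))
    (convex_convexHull ℝ (productPureStates a b) : Convex ℝ S)
    hS.isClosed fun h => hρ.2 (isSeparable_of_mem_convexHull h)
  -- All states compared have trace 1, so subtracting `u 𝕀` moves the separating threshold to 0. The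
  -- pairing is entrywise, without a transpose, to match what `contraction` produces.
  let W : BipartiteOp a b := Matrix.of fun p q => f (Pi.single p (Pi.single q 1)) -
    if p = q then (u : ℂ) else 0
  have hW : ∀ X : BipartiteOp a b, ∑ p, ∑ q, W p q * X p q = f X - u * X.trace := by
    intro X
    have h1 : (X : a × b → a × b → ℂ) =
        ∑ p, ∑ q, X p q • (Pi.single p (Pi.single q 1) : a × b → a × b → ℂ) := by
      ext p q
      simp [Finset.sum_apply, Pi.single_apply, apply_ite, ite_apply]
    have h2 : f X = ∑ p, ∑ q, X p q * f (Pi.single p (Pi.single q 1)) := by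
      conv_lhs => rw [h1]
      simp only [map_sum, map_smul, smul_eq_mul]
    rw [h2]
    simp only [W, Matrix.of_apply, sub_mul, Finset.sum_sub_distrib, ite_mul, zero_mul,
      Finset.sum_ite_eq, Finset.mem_univ, if_true, Matrix.trace, Matrix.diag_apply,
      Finset.mul_sum]
    simp only [mul_comm]
  -- Passing to the Hermitian part does not change the real part of the pairing with a Hermitian
  -- matrix.
  refine ⟨(1 / 2 : ℂ) • (W + Wᴴ), ?_, ?_, fun α β hα hβ => ?_⟩
  · ext p q
    simp [add_comm, mul_add]
  · rw [re_sum_hermitianPart W ρ hρ.1.1.isHermitian, hW, hρ.1.2]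
    simpa using hf1
  · rw [re_sum_hermitianPart W _ (productPure_posSemidef α β).isHermitian]
    obtain ⟨c, hc, hcα⟩ := exists_smul_normalized hα
    obtain ⟨d, hd, hdβ⟩ := exists_smul_normalized hβ
    have hm : productPure ((c : ℂ) • α) ((d : ℂ) • β) ∈ productPureStates a b :=
      ⟨((c : ℂ) • α, (d : ℂ) • β), ⟨hcα, hdβ⟩, rfl⟩
    have hm' : productPure ((c : ℂ) • α) ((d : ℂ) • β) ∈ convexHull ℝ (productPureStates a b) :=
      subset_convexHull ℝ _ hm
    have h3 : u < (f (productPure ((c : ℂ) • α) ((d : ℂ) • β))).re :=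
      hf2 _ hm'
    have h4 : ∑ p, ∑ q, W p q * productPure ((c : ℂ) • α) ((d : ℂ) • β) p q =
        ((c ^ 2 * d ^ 2 : ℝ) : ℂ) * ∑ p, ∑ q, W p q * productPure α β p q := by
      simp only [Finset.mul_sum]
      refine Finset.sum_congr rfl fun p _ => Finset.sum_congr rfl fun q _ => ?_
      rw [productPure_smul]
      ring
    have h5 := congrArg Complex.re h4
    rw [hW, trace_productPure hcα hdβ, Complex.re_ofReal_mul, mul_one, Complex.sub_re,
      Complex.ofReal_re] at h5
    have hr : 0 < c ^ 2 * d ^ 2 := by positivity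
    exact (mul_pos_iff_of_pos_left hr).1 (h5 ▸ sub_pos.2 h3)

end Witness
-- Domination of Hermitian matrices by multiples of the identity.
section Hermitian

open scoped MatrixOrder Matrix.Norms.L2Operator

theorem exists_smul_one_sub_posSemidef {n : Type*} [Fintype n] [DecidableEq n] {M : Matrix n n ℂ}
    (hM : M.IsHermitian) :
    ∃ C : ℝ, 0 < C ∧ ∀ t : ℝ, C ≤ t → ((t : ℂ) • (1 : Matrix n n ℂ) - M).PosSemidef := by
  have h : M ≤ algebraMap ℝ (Matrix n n ℂ) ‖M‖ :=
    IsSelfAdjoint.le_algebraMap_norm_self (a := M) hM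
  rw [Matrix.le_iff] at h
  -- The `+ 1` only makes the bound strictly positive, so that it can be divided by later.
  refine ⟨‖M‖ + 1, by positivity, fun t ht => ?_⟩
  have h2 : ((t - ‖M‖ : ℝ) : ℂ) • (1 : Matrix n n ℂ) + (algebraMap ℝ (Matrix n n ℂ) ‖M‖ - M) =
      (t : ℂ) • (1 : Matrix n n ℂ) - M := by
    rw [Algebra.algebraMap_eq_smul_one, ← Complex.coe_smul ‖M‖, Complex.ofReal_sub, sub_smul]
    abel
  rw [← h2]
  refine (Matrix.PosSemidef.smul .one ?_).add h
  exact_mod_cast (by linarith : 0 ≤ t - ‖M‖)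

end Hermitian

/-! ### The excess over singlet fraction one half. -/

/-- The excess `2 tr(M Φ(2)) - tr M` of a two-qubit operator over singlet fraction `1/2`. -/
noncomputable def excess (M : BipartiteOp (Fin 2) (Fin 2)) : ℝ :=
  (M (0, 0) (1, 1) + M (1, 1) (0, 0) - M (0, 1) (0, 1) - M (1, 0) (1, 0)).re

theorem two_mul_trace_mul_maxEntangled (M : BipartiteOp (Fin 2) (Fin 2)) :
    2 * (M * maxEntangled 2).trace.re =
      (M (0, 0) (0, 0) + M (0, 0) (1, 1) + M (1, 1) (0, 0) + M (1, 1) (1, 1)).re := by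
  simp [Matrix.trace, Matrix.mul_apply, maxEntangled, Fintype.sum_prod_type, Fin.sum_univ_two]
  ring

theorem excess_eq (M : BipartiteOp (Fin 2) (Fin 2)) :
    excess M = 2 * (M * maxEntangled 2).trace.re - M.trace.re := by
  rw [two_mul_trace_mul_maxEntangled]
  simp [excess, Matrix.trace, Fintype.sum_prod_type, Fin.sum_univ_two]
  ring

theorem excess_sum {ι : Type*} (s : Finset ι) (M : ι → BipartiteOp (Fin 2) (Fin 2)) :
    excess (∑ i ∈ s, M i) = ∑ i ∈ s, excess (M i) := by
  simp [excess, Matrix.sum_apply, Finset.sum_add_distrib, Finset.sum_sub_distrib]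

theorem excess_add (M N : BipartiteOp (Fin 2) (Fin 2)) :
    excess (M + N) = excess M + excess N := by
  simp [excess]
  ring

theorem excess_smul (c : ℝ) (M : BipartiteOp (Fin 2) (Fin 2)) :
    excess ((c : ℂ) • M) = c * excess M := by
  simp [excess]
  ring

theorem trace_mul_maxEntangled_le {M : BipartiteOp (Fin 2) (Fin 2)} (hM : M.PosSemidef) :
    (M * maxEntangled 2).trace.re ≤ M.trace.re := by
  have h1 := (Complex.nonneg_iff.1 (hM.diag_nonneg (i := (0, 1)))).1
  have h2 := (Complex.nonneg_iff.1 (hM.diag_nonneg (i := (1, 0)))).1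
  -- `𝕀 - Φ(2)` is the sum of the projections onto `|01⟩`, `|10⟩` and `(|00⟩ - |11⟩)/√2`; this is
  -- the third one, unnormalized.
  have h3 := (Complex.nonneg_iff.1 (hM.dotProduct_mulVec_nonneg
    (fun p => if p = (0, 0) then 1 else if p = (1, 1) then -1 else 0))).1
  have h4 := two_mul_trace_mul_maxEntangled M
  have h5 : M.trace.re = (M (0, 0) (0, 0)).re + (M (0, 1) (0, 1)).re + (M (1, 0) (1, 0)).re +
      (M (1, 1) (1, 1)).re := by
    simp [Matrix.trace, Fintype.sum_prod_type, Fin.sum_univ_two]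
    ring
  simp [dotProduct, Matrix.mulVec, Fintype.sum_prod_type, Fin.sum_univ_two] at h3
  simp at h4
  linarith

/-! ### Singlet fraction and excess under single Kraus operators. -/

section SingletFraction

variable {a b : Type*} [Fintype a] [DecidableEq a] [Fintype b] [DecidableEq b]

/-- No local operators into two qubits yield a singlet fraction above `1/2`. -/
def IsSingleCopyUndistillable {a b : Type*} [Fintype a] [Fintype b] (ω : BipartiteOp a b) : Prop :=
  ∀ (A : Matrix (Fin 2) a ℂ) (B : Matrix (Fin 2) b ℂ),
    excess ((A ⊗ₖ B) * ω * (A ⊗ₖ B)ᴴ) ≤ 0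

/-- The SLOCC map with a single Kraus operator `A ⊗ B`. -/
noncomputable def localMap {a b c d : Type*} [Fintype a] [Fintype b] (A : Matrix c a ℂ)
    (B : Matrix d b ℂ) : BipartiteOp a b →ₗ[ℂ] BipartiteOp c d where
  toFun X := (A ⊗ₖ B) * X * (A ⊗ₖ B)ᴴ
  map_add' X Y := by rw [Matrix.mul_add, Matrix.add_mul]
  map_smul' t X := by rw [Matrix.mul_smul, Matrix.smul_mul, RingHom.id_apply]

theorem isSLOCC_localMap {c d : Type*} [Fintype c] [Fintype d] {A : Matrix c a ℂ}
    {B : Matrix d b ℂ} (h : (1 - (Aᴴ * A) ⊗ₖ (Bᴴ * B)).PosSemidef) : IsSLOCC (localMap A B) :=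
  ⟨1, fun _ => A, fun _ => B, by simpa using h, fun X => by simp [localMap]⟩

theorem IsSLOCC.posSemidef {c d : Type*} [Fintype c] [Fintype d]
    {Ω : BipartiteOp a b →ₗ[ℂ] BipartiteOp c d} (hΩ : IsSLOCC Ω) {τ : BipartiteOp a b}
    (hτ : τ.PosSemidef) : (Ω τ).PosSemidef := by
  obtain ⟨r, A, B, -, hAB⟩ := hΩ
  rw [hAB]
  exact Matrix.posSemidef_sum _ fun i _ => hτ.mul_mul_conjTranspose_same _

theorem exists_diag_pos {n : Type*} [Fintype n] {ω : Matrix n n ℂ} (hω : IsState ω) :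
    ∃ p, 0 < (ω p p).re := by
  by_contra! h
  have h1 : ω.trace.re ≤ 0 := by
    rw [Matrix.trace, Complex.re_sum]
    exact Finset.sum_nonpos fun p _ => h p
  rw [hω.2, Complex.one_re] at h1
  linarith

/-- The value `1/2` is attained for every state: project onto a product basis vector of positive
weight and output `|00⟩`. It is not exceeded, since the excess is additive over Kraus operators. -/
theorem singletFraction_two_eq_half {ω : BipartiteOp a b} (hω : IsState ω)
    (h : IsSingleCopyUndistillable ω) : singletFraction 2 ω = 1 / 2 := by
  refine IsGreatest.csSup_eq ⟨?_, ?_⟩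
  · obtain ⟨⟨x, y⟩, hxy⟩ := exists_diag_pos hω
    let A : Matrix (Fin 2) a ℂ := Matrix.single 0 x 1
    let B : Matrix (Fin 2) b ℂ := Matrix.single 0 y 1
    have hAB : A ⊗ₖ B = Matrix.single (0, 0) (x, y) 1 := by
      simp [A, B, Matrix.single_kronecker_single]
    have hval : localMap A B ω = Matrix.single (0, 0) (0, 0) (ω (x, y) (x, y)) := by
      simp only [localMap, LinearMap.coe_mk, AddHom.coe_mk, hAB, Matrix.conjTranspose_single]
      simp
    have hid : (1 - (Aᴴ * A) ⊗ₖ (Bᴴ * B)).PosSemidef := by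
      have : (1 - (Aᴴ * A) ⊗ₖ (Bᴴ * B)) =
          Matrix.diagonal fun p : a × b => if p = (x, y) then (0 : ℂ) else 1 := by
        ext p q
        simp [A, B, Matrix.conjTranspose_single, Matrix.single_kronecker_single,
          Matrix.diagonal_apply, Matrix.one_apply, Matrix.single_apply]
        grind
      rw [this, Matrix.posSemidef_diagonal_iff]
      intro p
      split_ifs <;> simp
    refine ⟨localMap A B, isSLOCC_localMap hid, ?_, ?_⟩
    · simpa [hval] using hxy
    · have h2 := two_mul_trace_mul_maxEntangled (localMap A B ω)
      have h3 : (localMap A B ω).trace.re = (ω (x, y) (x, y)).re := by simp [hval]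
      rw [h3, eq_div_iff hxy.ne']
      simp [hval] at h2 ⊢
      linarith
  · rintro _ ⟨Ω, ⟨r, A, B, -, hAB⟩, hpos, rfl⟩
    have h1 : excess (Ω ω) ≤ 0 := by
      rw [hAB, excess_sum]
      exact Finset.sum_nonpos fun i _ => h _ _
    rw [excess_eq] at h1
    rw [div_le_iff₀ hpos]
    linarith

theorem half_lt_singletFraction_two {τ : BipartiteOp a b} (hτ : τ.PosSemidef)
    (A : Matrix (Fin 2) a ℂ) (B : Matrix (Fin 2) b ℂ)
    (h : 0 < excess ((A ⊗ₖ B) * τ * (A ⊗ₖ B)ᴴ)) : 1 / 2 < singletFraction 2 τ := by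
  have hherm : ((Aᴴ * A) ⊗ₖ (Bᴴ * B)).IsHermitian :=
    ((Matrix.posSemidef_conjTranspose_mul_self A).kronecker
      (Matrix.posSemidef_conjTranspose_mul_self B)).isHermitian
  obtain ⟨C, hC, hpsd⟩ := exists_smul_one_sub_posSemidef hherm
  -- Scaling `A` makes the pair a valid SLOCC map and multiplies the output by `C⁻¹ > 0`, which
  -- leaves the sign of the excess unchanged.
  let s : ℝ := (√C)⁻¹
  have hs : s * s = C⁻¹ := by
    rw [← mul_inv, Real.mul_self_sqrt hC.le]
  have hid : (1 - (((s : ℂ) • A)ᴴ * ((s : ℂ) • A)) ⊗ₖ (Bᴴ * B)).PosSemidef := by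
    have h1 : (1 - (((s : ℂ) • A)ᴴ * ((s : ℂ) • A)) ⊗ₖ (Bᴴ * B)) =
        ((C⁻¹ : ℝ) : ℂ) • ((C : ℂ) • 1 - (Aᴴ * A) ⊗ₖ (Bᴴ * B)) := by
      rw [smul_sub, smul_smul, ← Complex.ofReal_mul, inv_mul_cancel₀ hC.ne', Complex.ofReal_one,
        one_smul, Matrix.conjTranspose_smul, Matrix.smul_mul, Matrix.mul_smul, smul_smul,
        Matrix.smul_kronecker, ← hs]
      simp
    rw [h1]
    refine (hpsd C le_rfl).smul ?_
    exact_mod_cast (inv_pos.2 hC).le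
  have hΩ : IsSLOCC (localMap ((s : ℂ) • A) B) := isSLOCC_localMap hid
  have hM := hΩ.posSemidef hτ
  have hval : localMap ((s : ℂ) • A) B τ = ((C⁻¹ : ℝ) : ℂ) • ((A ⊗ₖ B) * τ * (A ⊗ₖ B)ᴴ) := by
    simp only [localMap, LinearMap.coe_mk, AddHom.coe_mk, Matrix.smul_kronecker,
      Matrix.conjTranspose_smul, Matrix.smul_mul, Matrix.mul_smul, smul_smul, ← hs]
    simp
  have hex : 0 < excess (localMap ((s : ℂ) • A) B τ) := by
    rw [hval, excess_smul]
    exact mul_pos (inv_pos.2 hC) h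
  have hle := trace_mul_maxEntangled_le hM
  rw [excess_eq] at hex
  have hpos : 0 < (localMap ((s : ℂ) • A) B τ).trace.re := by linarith
  refine lt_of_lt_of_le (b := (localMap ((s : ℂ) • A) B τ * maxEntangled 2).trace.re /
    (localMap ((s : ℂ) • A) B τ).trace.re) ?_ (le_csSup ?_ ⟨_, hΩ, hpos, rfl⟩)
  · rw [lt_div_iff₀ hpos]
    linarith
  · refine ⟨1, ?_⟩
    rintro _ ⟨Ω, hΩ', hpos', rfl⟩
    rw [div_le_one hpos']
    exact trace_mul_maxEntangled_le (hΩ'.posSemidef hτ)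

theorem IsSingleCopyUndistillable.smul {a b : Type*} [Fintype a] [Fintype b]
    {ω : BipartiteOp a b} (h : IsSingleCopyUndistillable ω) {c : ℝ} (hc : 0 ≤ c) :
    IsSingleCopyUndistillable ((c : ℂ) • ω) := fun A B => by
  rw [Matrix.mul_smul, Matrix.smul_mul, excess_smul]
  exact mul_nonpos_of_nonneg_of_nonpos hc (h A B)

theorem IsSingleCopyUndistillable.sum {a b ι : Type*} [Fintype a] [Fintype b]
    (s : Finset ι) {ω : ι → BipartiteOp a b}
    (h : ∀ i ∈ s, IsSingleCopyUndistillable (ω i)) :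
    IsSingleCopyUndistillable (∑ i ∈ s, ω i) := fun A B => by
  rw [Matrix.mul_sum, Matrix.sum_mul, excess_sum]
  exact Finset.sum_nonpos fun i hi => h i hi A B

theorem IsSingleCopyUndistillable.localMap {a b c d : Type*} [Fintype a] [Fintype b] [Fintype c]
    [Fintype d] {ω : BipartiteOp a b} (h : IsSingleCopyUndistillable ω) (J : Matrix c a ℂ)
    (J' : Matrix d b ℂ) : IsSingleCopyUndistillable ((J ⊗ₖ J') * ω * (J ⊗ₖ J')ᴴ) := fun A B => by
  have h1 : (A ⊗ₖ B) * ((J ⊗ₖ J') * ω * (J ⊗ₖ J')ᴴ) * (A ⊗ₖ B)ᴴ =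
      ((A * J) ⊗ₖ (B * J')) * ω * ((A * J) ⊗ₖ (B * J'))ᴴ := by
    rw [Matrix.mul_kronecker_mul, Matrix.conjTranspose_mul]
    simp only [Matrix.mul_assoc]
  rw [h1]
  exact h _ _

end SingletFraction
-- Symmetric extensions to `k` copies.
section Copies

variable {a b : Type*} [Fintype a] [DecidableEq a] [Fintype b] [DecidableEq b] {k : ℕ}

/-- The isometry that places a vector at copy `m` and the basis vector `x₀` at all other copies. -/
def insertCopy {k : ℕ} {a : Type*} [DecidableEq a] (x₀ : a) (m : Fin k) :
    Matrix (Fin k → a) a ℂ :=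
  Matrix.of fun s p => if s = Function.update (fun _ => x₀) m p then 1 else 0

theorem insertCopy_conjTranspose_mul_self (x₀ : a) (m : Fin k) :
    (insertCopy x₀ m)ᴴ * insertCopy x₀ m = 1 := by
  ext p q
  simp [insertCopy, Matrix.mul_apply, Matrix.one_apply,
    (Function.update_injective (fun _ => x₀) m).eq_iff, eq_comm]

/-- The state `σ` at copy `m`, the product basis state `|x₀ y₀⟩` at all other copies. -/
noncomputable def copyAt (x₀ : a) (y₀ : b) (m : Fin k) (σ : BipartiteOp a b) : CopiesOp k a b :=
  (insertCopy x₀ m ⊗ₖ insertCopy y₀ m) * σ * (insertCopy x₀ m ⊗ₖ insertCopy y₀ m)ᴴ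

theorem isState_copyAt (x₀ : a) (y₀ : b) (m : Fin k) {σ : BipartiteOp a b} (hσ : IsState σ) :
    IsState (copyAt x₀ y₀ m σ) := by
  refine ⟨hσ.1.mul_mul_conjTranspose_same _, ?_⟩
  rw [copyAt, Matrix.trace_mul_comm, ← Matrix.mul_assoc, Matrix.conjTranspose_kronecker,
    ← Matrix.mul_kronecker_mul, insertCopy_conjTranspose_mul_self,
    insertCopy_conjTranspose_mul_self, Matrix.one_kronecker_one, Matrix.one_mul, hσ.2]

theorem copyAt_apply (x₀ : a) (y₀ : b) (m : Fin k) (σ : BipartiteOp a b)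
    (s s' : Fin k → a) (t t' : Fin k → b) :
    copyAt x₀ y₀ m σ (s, t) (s', t') = ∑ p, ∑ q,
      if s = Function.update (fun _ => x₀) m p.1 ∧ t = Function.update (fun _ => y₀) m p.2 ∧
        s' = Function.update (fun _ => x₀) m q.1 ∧ t' = Function.update (fun _ => y₀) m q.2
      then σ p q else 0 := by
  simp only [copyAt, Matrix.mul_apply, Matrix.conjTranspose_apply, Matrix.kroneckerMap_apply,
    insertCopy, Matrix.of_apply, Finset.sum_mul]
  rw [Finset.sum_comm]
  refine Finset.sum_congr rfl fun p _ => Finset.sum_congr rfl fun q _ => ?_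
  split_ifs <;> simp_all

theorem comp_perm_eq_update_iff {a : Type*} (x₀ : a) (m : Fin k) (π : Equiv.Perm (Fin k))
    (s : Fin k → a) (p : a) :
    s ∘ π = Function.update (fun _ => x₀) m p ↔ s = Function.update (fun _ => x₀) (π m) p := by
  simp only [funext_iff, Function.comp_apply, Function.update_apply]
  rw [← π.forall_congr_right (q := fun i => s i = if i = π m then p else x₀)]
  simp

theorem copyAt_submatrix_perm (x₀ : a) (y₀ : b) (m : Fin k) (σ : BipartiteOp a b)
    (π : Equiv.Perm (Fin k)) :
    (copyAt x₀ y₀ m σ).submatrix (fun s => (s.1 ∘ π, s.2 ∘ π)) (fun s => (s.1 ∘ π, s.2 ∘ π)) =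
      copyAt x₀ y₀ (π m) σ := by
  ext ⟨s, t⟩ ⟨s', t'⟩
  simp only [Matrix.submatrix_apply, copyAt_apply, comp_perm_eq_update_iff]

theorem marginal_copyAt_apply (x₀ : a) (y₀ : b) (l m : Fin k) (σ : BipartiteOp a b)
    (x x' : a) (y y' : b) :
    marginal m (copyAt x₀ y₀ l σ) (x, y) (x', y') = ∑ p, ∑ q,
      if (Function.update (fun _ => x₀) l p.1 m = x ∧ Function.update (fun _ => y₀) l p.2 m = y) ∧
        Function.update (Function.update (fun _ => x₀) l p.1) m x' =
          Function.update (fun _ => x₀) l q.1 ∧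
        Function.update (Function.update (fun _ => y₀) l p.2) m y' =
          Function.update (fun _ => y₀) l q.2
      then σ p q else 0 := by
  have h : ∀ (s : Fin k → a) (t : Fin k → b),
      (if s m = x ∧ t m = y then
        copyAt x₀ y₀ l σ (s, t) (Function.update s m x', Function.update t m y') else 0) =
      ∑ p : a × b, ∑ q : a × b, if s = Function.update (fun _ => x₀) l p.1 then
        if t = Function.update (fun _ => y₀) l p.2 then
          if (s m = x ∧ t m = y) ∧
            Function.update s m x' = Function.update (fun _ => x₀) l q.1 ∧
            Function.update t m y' = Function.update (fun _ => y₀) l q.2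
          then σ p q else 0 else 0 else 0 := by
    intro s t
    rw [copyAt_apply]
    by_cases hc : s m = x ∧ t m = y
    · simp only [hc, and_self, true_and, if_true, ite_and]
    · simp only [hc, false_and, if_false, ite_self, Finset.sum_const_zero]
  simp only [marginal, Matrix.of_apply, h]
  have hswap : ∀ F : (Fin k → a) → (Fin k → b) → a × b → a × b → ℂ,
      ∑ s, ∑ t, ∑ p, ∑ q, F s t p q = ∑ p, ∑ q, ∑ s, ∑ t, F s t p q := by
    intro F
    rw [← Fintype.sum_prod_type' fun s t => ∑ p, ∑ q, F s t p q, Finset.sum_comm]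
    refine Finset.sum_congr rfl fun p _ => ?_
    rw [Finset.sum_comm]
    exact Finset.sum_congr rfl fun q _ => Fintype.sum_prod_type _
  rw [hswap]
  refine Finset.sum_congr rfl fun p _ => Finset.sum_congr rfl fun q _ => ?_
  rw [Finset.sum_comm]
  simp only [Finset.sum_ite_eq', Finset.mem_univ, if_true]

theorem marginal_copyAt_self (x₀ : a) (y₀ : b) (m : Fin k) (σ : BipartiteOp a b) :
    marginal m (copyAt x₀ y₀ m σ) = σ := by
  ext ⟨x, y⟩ ⟨x', y'⟩
  simp [marginal_copyAt_apply, (Function.update_injective (fun _ => x₀) m).eq_iff,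
    (Function.update_injective (fun _ => y₀) m).eq_iff, Fintype.sum_prod_type, ite_and]

theorem update_update_const_eq_iff {a : Type*} (x₀ : a) {l m : Fin k} (hlm : l ≠ m)
    (p x q : a) :
    Function.update (Function.update (fun _ => x₀) l p) m x = Function.update (fun _ => x₀) l q ↔
      p = q ∧ x = x₀ := by
  constructor
  · intro h
    have h1 := congrFun h l
    have h2 := congrFun h m
    simp_all [hlm.symm]
  · rintro ⟨rfl, rfl⟩
    rw [Function.update_eq_self_iff, Function.update_of_ne hlm.symm]

theorem marginal_copyAt_of_ne (x₀ : a) (y₀ : b) {l m : Fin k} (hlm : l ≠ m)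
    (σ : BipartiteOp a b) :
    marginal m (copyAt x₀ y₀ l σ) = σ.trace • Matrix.single (x₀, y₀) (x₀, y₀) 1 := by
  ext ⟨x, y⟩ ⟨x', y'⟩
  simp only [marginal_copyAt_apply, update_update_const_eq_iff _ hlm,
    Function.update_of_ne hlm.symm]
  have h : ∀ p q : a × b, (if (x₀ = x ∧ y₀ = y) ∧ (p.1 = q.1 ∧ x' = x₀) ∧ p.2 = q.2 ∧ y' = y₀
      then σ p q else 0) =
      if p = q then σ p q * if (x₀, y₀) = (x, y) ∧ (x₀, y₀) = (x', y') then 1 else 0 else 0 := by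
    intro p q
    simp only [Prod.ext_iff]
    grind
  simp only [h, Finset.sum_ite_eq, Finset.mem_univ, if_true, ← Finset.sum_mul]
  simp [Matrix.trace, Matrix.single_apply]

theorem marginal_sum {ι : Type*} (s : Finset ι) (m : Fin k) (ω : ι → CopiesOp k a b) :
    marginal m (∑ i ∈ s, ω i) = ∑ i ∈ s, marginal m (ω i) := by
  classical
  induction s using Finset.induction_on with
  | empty => ext; simp [marginal]
  | insert i s hi ih =>
    rw [Finset.sum_insert hi, Finset.sum_insert hi, ← ih]
    ext
    simp only [marginal, Matrix.of_apply, Matrix.add_apply, ← Finset.sum_add_distrib]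
    refine Finset.sum_congr rfl fun _ _ => Finset.sum_congr rfl fun _ _ => ?_
    split_ifs <;> simp

theorem marginal_smul (m : Fin k) (c : ℂ) (ω : CopiesOp k a b) :
    marginal m (c • ω) = c • marginal m ω := by
  ext
  simp only [marginal, Matrix.of_apply, Matrix.smul_apply, smul_eq_mul, Finset.mul_sum, mul_ite,
    mul_zero]

/-- The extension is the uniform mixture of the `copyAt x₀ y₀ l σ`. Permutations permute its terms;
each term is a local isometric image of `σ`. At copy `m` the term `l = m` gives `σ` and the other `k
- 1` give the product state. -/
theorem isCopyCorrelatedUndistillable_mix {σ : BipartiteOp a b} (hσ : IsState σ)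
    (h : IsSingleCopyUndistillable σ) (hk : 1 ≤ k) (x₀ : a) (y₀ : b) :
    IsCopyCorrelatedUndistillable k (((k : ℝ)⁻¹ : ℂ) •
      (σ + ((k : ℂ) - 1) • Matrix.single (x₀, y₀) (x₀, y₀) 1)) := by
  have hk0 : (k : ℂ) ≠ 0 := by exact_mod_cast (by omega : k ≠ 0)
  have hinv : (0 : ℂ) ≤ ((k : ℝ)⁻¹ : ℂ) := by
    exact_mod_cast (by positivity : (0 : ℝ) ≤ (k : ℝ)⁻¹)
  let ω : CopiesOp k a b := ((k : ℝ)⁻¹ : ℂ) • ∑ l, copyAt x₀ y₀ l σ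
  have hω : IsState ω := by
    refine ⟨(Matrix.posSemidef_sum _ fun l _ => (isState_copyAt x₀ y₀ l hσ).1).smul hinv, ?_⟩
    simp only [ω, Matrix.trace_smul, Matrix.trace_sum, (isState_copyAt x₀ y₀ _ hσ).2]
    simp [hk0]
  have hmarg : ∀ m, marginal m ω = ((k : ℝ)⁻¹ : ℂ) •
      (σ + ((k : ℂ) - 1) • Matrix.single (x₀, y₀) (x₀, y₀) 1) := by
    intro m
    simp only [ω, marginal_smul, marginal_sum]
    congr 1
    rw [← Finset.add_sum_erase _ _ (Finset.mem_univ m), marginal_copyAt_self]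
    congr 1
    rw [Finset.sum_congr rfl fun l hl => marginal_copyAt_of_ne x₀ y₀ (Finset.ne_of_mem_erase hl) σ,
      Finset.sum_const, Finset.card_erase_of_mem (Finset.mem_univ m), Finset.card_univ,
      Fintype.card_fin, hσ.2, one_smul, ← Nat.cast_smul_eq_nsmul ℂ, Nat.cast_sub hk, Nat.cast_one]
  refine ⟨⟨?_, ?_⟩, ω, hω, fun π => ?_, ?_, hmarg⟩
  · refine (hσ.1.add (Matrix.PosSemidef.smul ?_ ?_)).smul hinv
    · rw [← Matrix.diagonal_single, Matrix.posSemidef_diagonal_iff]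
      intro p
      by_cases hp : p = (x₀, y₀)
      · subst hp; simp
      · simp [hp]
    · rw [sub_nonneg]
      exact_mod_cast hk
  · rw [Matrix.trace_smul, Matrix.trace_add, Matrix.trace_smul, hσ.2, Matrix.trace_single_eq_same]
    simp [hk0]
  · simp only [ω, Matrix.submatrix_smul, Pi.smul_apply]
    congr 1
    conv_rhs => rw [← Equiv.sum_comp π]
    ext p q
    simp only [← copyAt_submatrix_perm, Matrix.submatrix_apply, Matrix.sum_apply]
  · refine singletFraction_two_eq_half hω ?_
    have h1 : IsSingleCopyUndistillable (∑ l : Fin k, copyAt x₀ y₀ l σ) :=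
      IsSingleCopyUndistillable.sum _ fun l _ => h.localMap _ _
    have h2 := h1.smul (c := (k : ℝ)⁻¹) (by positivity)
    rwa [Complex.ofReal_inv] at h2

end Copies
-- Partial transposes and vectors of Schmidt rank two.
/-- The expectation of the partial transpose of `σ` in the (conjugated) vector `u`. -/
noncomputable def partialTransposeForm {c d : Type*} [Fintype c] [Fintype d] (σ : BipartiteOp c d)
    (u : c → d → ℂ) : ℝ :=
  (∑ p, ∑ q, u p.1 q.2 * star (u q.1 p.2) * σ p q).re

/-- The excess is the trace against `2Φ(2) - 𝕀`, which is minus the partial transpose of the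
unnormalized singlet projection. Moving the transpose onto `σ` conjugates `B`, and the pulled-back
singlet has rank at most 2. -/
theorem excess_local_eq {c d : Type*} [Fintype c] [Fintype d] (σ : BipartiteOp c d)
    (A : Matrix (Fin 2) c ℂ) (B : Matrix (Fin 2) d ℂ) :
    excess ((A ⊗ₖ B) * σ * (A ⊗ₖ B)ᴴ) =
      -partialTransposeForm σ fun p s => A 0 p * star (B 1 s) - A 1 p * star (B 0 s) := by
  have h : ∀ i k : Fin 2 × Fin 2, ((A ⊗ₖ B) * σ * (A ⊗ₖ B)ᴴ) i k =
      ∑ p, ∑ q, A i.1 p.1 * B i.2 p.2 * σ p q * star (A k.1 q.1 * B k.2 q.2) := by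
    intro i k
    simp only [Matrix.mul_apply, Matrix.conjTranspose_apply, Matrix.kroneckerMap_apply,
      Finset.sum_mul]
    exact Finset.sum_comm
  rw [excess, partialTransposeForm, ← Complex.neg_re]
  congr 1
  simp only [h, ← Finset.sum_add_distrib, ← Finset.sum_sub_distrib, ← Finset.sum_neg_distrib]
  refine Finset.sum_congr rfl fun p _ => Finset.sum_congr rfl fun q _ => ?_
  simp only [star_mul', star_sub, star_star]
  ring

theorem partialTransposeForm_add {c d : Type*} [Fintype c] [Fintype d] (σ τ : BipartiteOp c d)
    (u : c → d → ℂ) :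
    partialTransposeForm (σ + τ) u = partialTransposeForm σ u + partialTransposeForm τ u := by
  simp only [partialTransposeForm, Matrix.add_apply, mul_add, Finset.sum_add_distrib,
    Complex.add_re]

theorem partialTransposeForm_smul {c d : Type*} [Fintype c] [Fintype d] (t : ℝ)
    (σ : BipartiteOp c d) (u : c → d → ℂ) :
    partialTransposeForm ((t : ℂ) • σ) u = t * partialTransposeForm σ u := by
  simp only [partialTransposeForm, Matrix.smul_apply, smul_eq_mul, ← Complex.re_ofReal_mul,
    Finset.mul_sum]
  congr 1
  refine Finset.sum_congr rfl fun p _ => Finset.sum_congr rfl fun q _ => ?_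
  ring

theorem partialTransposeForm_smul_right {c d : Type*} [Fintype c] [Fintype d] (r : ℝ)
    (σ : BipartiteOp c d) (u : c → d → ℂ) :
    partialTransposeForm σ (r • u) = r ^ 2 * partialTransposeForm σ u := by
  simp only [partialTransposeForm, Pi.smul_apply, ← Complex.re_ofReal_mul, Finset.mul_sum,
    Complex.real_smul, star_mul', RCLike.star_def, Complex.conj_ofReal]
  congr 1
  refine Finset.sum_congr rfl fun p _ => Finset.sum_congr rfl fun q _ => ?_
  push_cast
  ring

theorem continuous_partialTransposeForm {c d : Type*} [Fintype c] [Fintype d]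
    (σ : BipartiteOp c d) : Continuous (partialTransposeForm σ) := by
  unfold partialTransposeForm
  fun_prop

/-- On a compact set, a function that is positive where a nonnegative function `P` vanishes becomes
nonnegative after adding a large multiple of `P`. -/
theorem exists_forall_mul_add_nonneg {X : Type*} [TopologicalSpace X] {K : Set X}
    (hK : IsCompact K) {P Q : X → ℝ} (hP : Continuous P) (hQ : Continuous Q)
    (hP0 : ∀ u ∈ K, 0 ≤ P u) (hPQ : ∀ u ∈ K, P u = 0 → 0 < Q u) :
    ∃ t₀ : ℝ, ∀ t, t₀ ≤ t → ∀ u ∈ K, 0 ≤ t * P u + Q u := by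
  have hK' : IsCompact (K ∩ {u | Q u ≤ 0}) :=
    hK.inter_right (isClosed_le hQ continuous_const)
  have hpos : ∀ u ∈ K ∩ {u | Q u ≤ 0}, 0 < P u := fun u hu =>
    (hP0 u hu.1).lt_of_ne' fun h => (hPQ u hu.1 h).not_ge hu.2
  obtain ⟨t₀, ht₀⟩ := hK'.bddAbove_image (f := fun u => -Q u / P u)
    (hQ.neg.continuousOn.div hP.continuousOn fun u hu => (hpos u hu).ne')
  refine ⟨max t₀ 0, fun t ht u hu => ?_⟩
  rcases le_total (Q u) 0 with h | h
  · have h1 : -Q u / P u ≤ t := (ht₀ ⟨u, ⟨hu, h⟩, rfl⟩).trans ((le_max_left _ _).trans ht)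
    rw [div_le_iff₀ (hpos u ⟨hu, h⟩)] at h1
    linarith
  · have := mul_nonneg ((le_max_right _ _).trans ht) (hP0 u hu)
    linarith

/-- All `3 × 3` minors vanish. -/
def MinorsVanish {c d : Type*} (u : c → d → ℂ) : Prop :=
  ∀ (r : Fin 3 → c) (s : Fin 3 → d), (Matrix.of fun i j => u (r i) (s j)).det = 0

theorem minorsVanish_of_rank_two {c d : Type*} (f₀ f₁ : c → ℂ) (g₀ g₁ : d → ℂ) :
    MinorsVanish fun p s => f₀ p * g₁ s - f₁ p * g₀ s := by
  intro r s
  rw [Matrix.det_fin_three]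
  simp only [Matrix.of_apply]
  ring

theorem MinorsVanish.smul {c d : Type*} {u : c → d → ℂ} (h : MinorsVanish u) (t : ℝ) :
    MinorsVanish (t • u) := by
  intro r s
  have h1 := h r s
  rw [Matrix.det_fin_three] at h1 ⊢
  simp only [Matrix.of_apply, Pi.smul_apply, Complex.real_smul] at h1 ⊢
  linear_combination (t : ℂ) ^ 3 * h1

/-- The rank bound is expressed by minors so as to be visibly closed: its intersection with the unit
sphere is then compact. -/
theorem isClosed_minorsVanish (c d : Type*) : IsClosed {u : c → d → ℂ | MinorsVanish u} := by
  simp only [MinorsVanish, Set.ofPred_forall]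
  refine isClosed_iInter fun r => isClosed_iInter fun s => isClosed_eq ?_ continuous_const
  simp only [Matrix.det_fin_three, Matrix.of_apply]
  fun_prop

/-! ### The activator: positivity and undistillability. -/

section Activator

variable {a b : Type*} [Fintype a] [DecidableEq a] [Fintype b] [DecidableEq b]

theorem sum_bipartite_qubit {M : Type*} [AddCommMonoid M] {a b : Type*} [Fintype a] [Fintype b]
    (f : (a × Fin 2) × (b × Fin 2) → M) :
    ∑ p, f p = ∑ r : a × b, (f ((r.1, 0), (r.2, 0)) + f ((r.1, 0), (r.2, 1)) +
      (f ((r.1, 1), (r.2, 0)) + f ((r.1, 1), (r.2, 1)))) := by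
  rw [← Equiv.sum_comp (Equiv.prodProdProdComm a b (Fin 2) (Fin 2)), Fintype.sum_prod_type]
  simp [Fintype.sum_prod_type, Fin.sum_univ_two]

/-- The operator `𝕀 ⊗ 2 Φ(2)`, with `𝕀` on `ℋ_A ⊗ ℋ_B`. -/
def bellPart (a b : Type*) [DecidableEq a] [DecidableEq b] :
    BipartiteOp (a × Fin 2) (b × Fin 2) :=
  Matrix.of fun p q =>
    if p.1.2 = p.2.2 ∧ q.1.2 = q.2.2 ∧ p.1.1 = q.1.1 ∧ p.2.1 = q.2.1 then 1 else 0

/-- The operator `W ⊗ (𝕀 - 2 Φ(2))`. -/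
def witnessPart {a b : Type*} (W : BipartiteOp a b) : BipartiteOp (a × Fin 2) (b × Fin 2) :=
  Matrix.of fun p q => W (p.1.1, p.2.1) (q.1.1, q.2.1) *
    ((if p.1.2 = q.1.2 ∧ p.2.2 = q.2.2 then 1 else 0) -
      if p.1.2 = p.2.2 ∧ q.1.2 = q.2.2 then 1 else 0)

/-- The activating operator `t 𝕀 ⊗ (𝕀 + 2 Φ(2)) + W ⊗ (𝕀 - 2 Φ(2))`, unnormalized. -/
noncomputable def activator (W : BipartiteOp a b) (t : ℝ) : BipartiteOp (a × Fin 2) (b × Fin 2) :=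
  (t : ℂ) • (1 + bellPart a b) + witnessPart W

theorem bellPart_posSemidef : (bellPart a b).PosSemidef := by
  let G : Matrix ((a × Fin 2) × (b × Fin 2)) (a × b) ℂ :=
    Matrix.of fun p r => if p.1.2 = p.2.2 ∧ p.1.1 = r.1 ∧ p.2.1 = r.2 then 1 else 0
  have h : bellPart a b = G * Gᴴ := by
    ext ⟨⟨x, i⟩, ⟨y, j⟩⟩ ⟨⟨x', k⟩, ⟨y', l⟩⟩
    simp only [bellPart, G, Matrix.of_apply, Matrix.mul_apply, Matrix.conjTranspose_apply,
      Fintype.sum_prod_type, ite_and]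
    by_cases h1 : i = j <;> by_cases h2 : k = l <;> simp [h1, h2, apply_ite star]
  rw [h]
  exact Matrix.posSemidef_self_mul_conjTranspose G

theorem witnessPart_isHermitian {a b : Type*} {W : BipartiteOp a b} (hW : W.IsHermitian) :
    (witnessPart W).IsHermitian := by
  refine Matrix.IsHermitian.ext fun p q => ?_
  simp only [witnessPart, Matrix.of_apply, star_mul', hW.apply, star_sub]
  congr 1
  simp only [apply_ite star, star_one, star_zero, eq_comm, and_comm]

theorem exists_activator_posSemidef {W : BipartiteOp a b} (hW : W.IsHermitian) :
    ∃ t₀ : ℝ, ∀ t, t₀ ≤ t → (activator W t).PosSemidef := by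
  obtain ⟨C, hC, h⟩ := exists_smul_one_sub_posSemidef (witnessPart_isHermitian hW).neg
  refine ⟨C, fun t ht => ?_⟩
  have h1 : activator W t = (t : ℂ) • bellPart a b + ((t : ℂ) • 1 - -witnessPart W) := by
    rw [activator, smul_add]
    abel
  rw [h1]
  refine (bellPart_posSemidef.smul ?_).add (h t ht)
  exact_mod_cast hC.le.trans ht

/-- Partial transposition turns `𝕀 + 2Φ(2)` into identity plus swap, twice the symmetric projection;
the form vanishes exactly on vectors antisymmetric in the qubits. -/
theorem partialTransposeForm_one_add_bellPart (u : a × Fin 2 → b × Fin 2 → ℂ) :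
    partialTransposeForm (1 + bellPart a b) u = ∑ r : a × b,
      (2 * ‖u (r.1, 0) (r.2, 0)‖ ^ 2 + 2 * ‖u (r.1, 1) (r.2, 1)‖ ^ 2 +
        ‖u (r.1, 0) (r.2, 1) + u (r.1, 1) (r.2, 0)‖ ^ 2) := by
  simp only [partialTransposeForm, sum_bipartite_qubit, Complex.re_sum]
  refine Finset.sum_congr rfl fun r _ => ?_
  simp only [← Finset.sum_add_distrib]
  rw [Finset.sum_eq_single r]
  · simp only [← Complex.normSq_eq_norm_sq, Complex.normSq_apply]
    simp [bellPart]
    ring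
  · intro r' _ hr
    have h1 : ∀ i j k l : Fin 2, (1 + bellPart a b) ((r.1, i), (r.2, j)) ((r'.1, k), (r'.2, l)) =
        0 := by
      intro i j k l
      have h2 : ¬(r.1 = r'.1 ∧ r.2 = r'.2) := fun h => hr (Prod.ext h.1.symm h.2.symm)
      simp only [bellPart, Matrix.add_apply, Matrix.one_apply, Matrix.of_apply, Prod.mk.injEq]
      rw [if_neg (by tauto), if_neg (by tauto), add_zero]
    simp [h1]
  · simp

theorem partialTransposeForm_witnessPart {a b : Type*} [Fintype a] [Fintype b] (W : BipartiteOp a b)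
    (u : a × Fin 2 → b × Fin 2 → ℂ) :
    partialTransposeForm (witnessPart W) u = partialTransposeForm W fun x y =>
      u (x, 0) (y, 1) - u (x, 1) (y, 0) := by
  simp only [partialTransposeForm, sum_bipartite_qubit, ← Finset.sum_add_distrib]
  congr 1
  refine Finset.sum_congr rfl fun p _ => Finset.sum_congr rfl fun q _ => ?_
  simp [witnessPart]
  ring

/-- On product vectors a partial transpose merely conjugates one factor, so positivity of `W` on
product vectors carries over. -/
theorem partialTransposeForm_mul {a b : Type*} [Fintype a] [Fintype b] (W : BipartiteOp a b)
    (f : a → ℂ) (g : b → ℂ) :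
    partialTransposeForm W (fun x y => f x * g y) =
      (∑ p, ∑ q, W p q * productPure f (star g) p q).re := by
  rw [partialTransposeForm]
  congr 1
  refine Finset.sum_congr rfl fun p _ => Finset.sum_congr rfl fun q _ => ?_
  simp only [productPure, Matrix.kroneckerMap_apply, Matrix.vecMulVec_apply, Pi.star_apply,
    star_mul', star_star]
  ring

theorem partialTransposeForm_witnessPart_pos {W : BipartiteOp a b}
    (hW : ∀ (α : a → ℂ) (β : b → ℂ), α ≠ 0 → β ≠ 0 →
      0 < (∑ p, ∑ q, W p q * productPure α β p q).re)
    {u : a × Fin 2 → b × Fin 2 → ℂ} (hu : MinorsVanish u) (hu0 : u ≠ 0)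
    (h : partialTransposeForm (1 + bellPart a b) u = 0) :
    0 < partialTransposeForm (witnessPart W) u := by
  rw [partialTransposeForm_one_add_bellPart, Finset.sum_eq_zero_iff_of_nonneg
    fun r _ => by positivity] at h
  have h00 : ∀ x y, u (x, 0) (y, 0) = 0 := fun x y => by
    have := h (x, y) (Finset.mem_univ _)
    rw [← norm_eq_zero, ← sq_eq_zero_iff]
    nlinarith [sq_nonneg ‖u (x, 0) (y, 0)‖, sq_nonneg ‖u (x, 1) (y, 1)‖,
      sq_nonneg ‖u (x, 0) (y, 1) + u (x, 1) (y, 0)‖]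
  have h11 : ∀ x y, u (x, 1) (y, 1) = 0 := fun x y => by
    have := h (x, y) (Finset.mem_univ _)
    rw [← norm_eq_zero, ← sq_eq_zero_iff]
    nlinarith [sq_nonneg ‖u (x, 0) (y, 0)‖, sq_nonneg ‖u (x, 1) (y, 1)‖,
      sq_nonneg ‖u (x, 0) (y, 1) + u (x, 1) (y, 0)‖]
  have h10 : ∀ x y, u (x, 1) (y, 0) = -u (x, 0) (y, 1) := fun x y => by
    have := h (x, y) (Finset.mem_univ _)
    rw [eq_neg_iff_add_eq_zero, add_comm, ← norm_eq_zero, ← sq_eq_zero_iff]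
    nlinarith [sq_nonneg ‖u (x, 0) (y, 0)‖, sq_nonneg ‖u (x, 1) (y, 1)‖,
      sq_nonneg ‖u (x, 0) (y, 1) + u (x, 1) (y, 0)‖]
  obtain ⟨x, y, hxy⟩ : ∃ x y, u (x, 0) (y, 1) ≠ 0 := by
    by_contra! hzero
    refine hu0 (funext fun ⟨x, i⟩ => funext fun ⟨y, j⟩ => ?_)
    fin_cases i <;> fin_cases j <;> simp [h00, h11, h10, hzero]
  have hprod : ∀ x' y', u (x', 0) (y', 1) =
      u (x', 0) (y, 1) * (u (x, 0) (y', 1) / u (x, 0) (y, 1)) := by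
    intro x' y'
    -- With `v x y = u (x, 0) (y, 1)`, this minor is `-v x y` times the `2 × 2` minor of `v` on rows
    -- `x, x'` and columns `y, y'`. As `v x y ≠ 0`, `v` has rank one.
    have hdet := hu ![(x, 0), (x, 1), (x', 0)] ![(y, 1), (y, 0), (y', 1)]
    rw [Matrix.det_fin_three] at hdet
    simp [h00, h11, h10] at hdet
    rw [mul_div_assoc', eq_div_iff hxy]
    refine mul_left_cancel₀ hxy ?_
    linear_combination -hdet
  have heq : (fun x' y' => u (x', 0) (y', 1) - u (x', 1) (y', 0)) =
      fun x' y' => (2 * u (x', 0) (y, 1)) * (u (x, 0) (y', 1) / u (x, 0) (y, 1)) := by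
    funext x' y'
    rw [h10, hprod x' y']
    ring
  rw [partialTransposeForm_witnessPart, heq, partialTransposeForm_mul]
  refine hW _ _ (fun h0 => ?_) fun h0 => ?_
  · have := congrFun h0 x
    simp [hxy] at this
  · have := congrFun h0 y
    simp [hxy] at this

theorem exists_activator_undistillable {W : BipartiteOp a b}
    (hW : ∀ (α : a → ℂ) (β : b → ℂ), α ≠ 0 → β ≠ 0 →
      0 < (∑ p, ∑ q, W p q * productPure α β p q).re) :
    ∃ t₀ : ℝ, ∀ t, t₀ ≤ t → IsSingleCopyUndistillable (activator W t) := by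
  have hK : IsCompact (Metric.sphere (0 : a × Fin 2 → b × Fin 2 → ℂ) 1 ∩
      {u | MinorsVanish u}) :=
    (isCompact_sphere _ _).inter_right (isClosed_minorsVanish _ _)
  obtain ⟨t₀, ht₀⟩ := exists_forall_mul_add_nonneg hK
    (continuous_partialTransposeForm (1 + bellPart a b))
    (continuous_partialTransposeForm (witnessPart W))
    (fun u _ => by
      rw [partialTransposeForm_one_add_bellPart]
      exact Finset.sum_nonneg fun r _ => by positivity)
    fun u hu h => partialTransposeForm_witnessPart_pos hW hu.2
      (ne_zero_of_mem_unit_sphere ⟨u, hu.1⟩) h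
  refine ⟨t₀, fun t ht A B => ?_⟩
  rw [excess_local_eq, Left.neg_nonpos_iff]
  have hmin := minorsVanish_of_rank_two (A 0) (A 1) (star (B 0)) (star (B 1))
  simp only [Pi.star_apply] at hmin
  generalize (fun p s => A 0 p * star (B 1 s) - A 1 p * star (B 0 s)) = u at hmin ⊢
  by_cases hu : u = 0
  · simp [hu, partialTransposeForm]
  · have hn : 0 < ‖u‖ := norm_pos_iff.2 hu
    -- The form is quadratic in `u`, so the unit sphere suffices.
    have h1 := ht₀ t ht (‖u‖⁻¹ • u) ⟨by simp [norm_smul, hn.ne'], hmin.smul _⟩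
    rw [← partialTransposeForm_smul, ← partialTransposeForm_add,
      partialTransposeForm_smul_right] at h1
    exact nonneg_of_mul_nonneg_right h1 (by positivity)

end Activator
-- Contracting the joint state to two qubits.
theorem tensor_posSemidef {a b c d : Type*} [Fintype a] [Fintype b] [Fintype c] [Fintype d]
    {ρ : BipartiteOp a b} {σ : BipartiteOp c d} (hρ : ρ.PosSemidef) (hσ : σ.PosSemidef) :
    (tensor ρ σ).PosSemidef :=
  (hρ.kronecker hσ).submatrix _

theorem tensor_add {a b c d : Type*} (ρ : BipartiteOp a b) (σ τ : BipartiteOp c d) :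
    tensor ρ (σ + τ) = tensor ρ σ + tensor ρ τ := by
  rw [tensor, Matrix.kronecker_add, Matrix.submatrix_add]
  rfl

theorem tensor_smul {a b c d : Type*} (ρ : BipartiteOp a b) (s : ℂ) (σ : BipartiteOp c d) :
    tensor ρ (s • σ) = s • tensor ρ σ := by
  rw [tensor, Matrix.kronecker_smul, Matrix.submatrix_smul]
  rfl

theorem IsSingleCopyUndistillable.submatrix {a b c d : Type*} [Fintype a] [Fintype b] [Fintype c]
    [Fintype d] {ω : BipartiteOp a b} (h : IsSingleCopyUndistillable ω) (e : c ≃ a) (f : d ≃ b) :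
    IsSingleCopyUndistillable
      (ω.submatrix (Equiv.prodCongr e f) (Equiv.prodCongr e f) : BipartiteOp c d) := by
  intro A B
  have h1 : A ⊗ₖ B = ((A.submatrix id e.symm) ⊗ₖ (B.submatrix id f.symm)).submatrix id
      (Equiv.prodCongr e f) := by
    ext
    simp
  rw [h1, Matrix.conjTranspose_submatrix, Matrix.submatrix_mul_equiv, Matrix.submatrix_mul_equiv,
    Matrix.submatrix_id_id]
  exact h _ _

section Contraction

variable {a b c d : Type*} [Fintype a] [Fintype b] [Fintype c] [Fintype d]
  [DecidableEq c] [DecidableEq d]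

/-- The local operator that contracts the first tensor factor with the `ℋ`-part of the second one
(identified with `ℋ ⊗ ℂ²` through `e`), leaving the qubit. -/
def contraction {a c : Type*} [DecidableEq c] (e : c ≃ a × Fin 2) :
    Matrix (Fin 2) (a × c) ℂ :=
  Matrix.of fun i z => if z.2 = e.symm (z.1, i) then 1 else 0

theorem contraction_mul_tensor_mul (ρ : BipartiteOp a b) (σ : BipartiteOp c d)
    (e : c ≃ a × Fin 2) (f : d ≃ b × Fin 2) (i k : Fin 2 × Fin 2) :
    ((contraction e ⊗ₖ contraction f) * tensor ρ σ * (contraction e ⊗ₖ contraction f)ᴴ) i k =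
      ∑ r, ∑ r', ρ r r' * σ (e.symm (r.1, i.1), f.symm (r.2, i.2))
        (e.symm (r'.1, k.1), f.symm (r'.2, k.2)) := by
  have hsum : ∀ (i : Fin 2 × Fin 2) (F : (a × c) × (b × d) → ℂ),
      ∑ z, (contraction e ⊗ₖ contraction f) i z * F z =
        ∑ r : a × b, F ((r.1, e.symm (r.1, i.1)), (r.2, f.symm (r.2, i.2))) := by
    intro i F
    rw [← Equiv.sum_comp (Equiv.prodProdProdComm a b c d), Fintype.sum_prod_type]
    refine Finset.sum_congr rfl fun r _ => ?_
    simp [contraction, Fintype.sum_prod_type]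
  have hstar : ∀ z, (contraction e ⊗ₖ contraction f)ᴴ z k =
      (contraction e ⊗ₖ contraction f) k z := by
    intro z
    simp [contraction, apply_ite star]
  rw [Matrix.mul_apply]
  simp only [hstar, Matrix.mul_apply, hsum]
  simp only [mul_comm _ ((contraction e ⊗ₖ contraction f) k _), hsum]
  rw [Finset.sum_comm]
  rfl

/-- Both qubits of the product state are `|0⟩`, so the output is a multiple of `|00⟩⟨00|`, an entry
the excess does not see. Dilution by this state therefore costs only a positive factor. -/
theorem excess_contraction_single (ρ : BipartiteOp a b) (e : c ≃ a × Fin 2)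
    (f : d ≃ b × Fin 2) (x : a) (y : b) :
    excess ((contraction e ⊗ₖ contraction f) *
      tensor ρ (Matrix.single (e.symm (x, 0), f.symm (y, 0)) (e.symm (x, 0), f.symm (y, 0)) 1) *
        (contraction e ⊗ₖ contraction f)ᴴ) = 0 := by
  simp [excess, contraction_mul_tensor_mul]

end Contraction

/-! ### Activation of an arbitrary entangled state. -/

section Activation

variable {a b c d : Type*} [Fintype a] [DecidableEq a] [Fintype b] [DecidableEq b]
  [Fintype c] [DecidableEq c] [Fintype d] [DecidableEq d]

/-- `𝕀 + 2Φ(2)` has excess `1 + 1 - 1 - 1 = 0`, so `t` can be as large as needed; `𝕀 - 2Φ(2)` has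
excess `-4`. -/
theorem excess_contraction_activator (ρ W : BipartiteOp a b) (t : ℝ) (e : c ≃ a × Fin 2)
    (f : d ≃ b × Fin 2) :
    excess ((contraction e ⊗ₖ contraction f) *
      tensor ρ ((activator W t).submatrix (Equiv.prodCongr e f) (Equiv.prodCongr e f)) *
        (contraction e ⊗ₖ contraction f)ᴴ) = -4 * (∑ p, ∑ q, W p q * ρ p q).re := by
  have h : (-4 * (∑ p, ∑ q, W p q * ρ p q).re) = (((-4 : ℝ) : ℂ) * ∑ p, ∑ q, W p q * ρ p q).re := by
    rw [Complex.re_ofReal_mul]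
  rw [excess, h]
  congr 1
  simp only [contraction_mul_tensor_mul, ← Finset.sum_add_distrib, ← Finset.sum_sub_distrib,
    Finset.mul_sum]
  refine Finset.sum_congr rfl fun r _ => Finset.sum_congr rfl fun r' _ => ?_
  by_cases hr : r.1 = r'.1 ∧ r.2 = r'.2
  · obtain rfl : r = r' := Prod.ext hr.1 hr.2
    simp [activator, bellPart, witnessPart]
    ring
  · simp [activator, bellPart, witnessPart, hr]
    ring

theorem exists_isCopyCorrelatedUndistillable_half_lt {ρ : BipartiteOp a b} (hρ : IsEntangled ρ)
    {k : ℕ} (hk : 1 ≤ k) (e : c ≃ a × Fin 2) (f : d ≃ b × Fin 2) :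
    ∃ σ : BipartiteOp c d, IsCopyCorrelatedUndistillable k σ ∧
      1 / 2 < singletFraction 2 (tensor ρ σ) := by
  obtain ⟨W, hW, hneg, hpos⟩ := exists_entanglement_witness hρ
  obtain ⟨t₁, ht₁⟩ := exists_activator_posSemidef hW
  obtain ⟨t₂, ht₂⟩ := exists_activator_undistillable hpos
  -- Only the existence of basis indices matters here; they fix the product state that fills the
  -- other copies.
  obtain ⟨⟨x, y⟩, -⟩ := exists_diag_pos hρ.1
  let τ : BipartiteOp c d :=
    (activator W (max t₁ t₂)).submatrix (Equiv.prodCongr e f) (Equiv.prodCongr e f)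
  have hτ : τ.PosSemidef := (ht₁ _ (le_max_left _ _)).submatrix _
  have hτu : IsSingleCopyUndistillable τ := (ht₂ _ (le_max_right _ _)).submatrix e f
  have hex : 0 < excess ((contraction e ⊗ₖ contraction f) * tensor ρ τ *
      (contraction e ⊗ₖ contraction f)ᴴ) := by
    rw [excess_contraction_activator]
    linarith
  -- Normalizing needs a nonzero trace; a zero `τ` could not yield positive excess.
  have hτ0 : τ ≠ 0 := by
    intro h0
    simp [h0, tensor, excess] at hex
  have hre : τ.trace = (τ.trace.re : ℂ) := Complex.eq_re_of_ofReal_le (r := 0) (by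
    simpa using hτ.trace_nonneg)
  have htr : 0 < τ.trace.re := by
    refine (Complex.nonneg_iff.1 hτ.trace_nonneg).1.lt_of_ne' fun h0 => hτ0 ?_
    rw [h0, Complex.ofReal_zero] at hre
    exact hτ.trace_eq_zero_iff.1 hre
  have hc : 0 < τ.trace.re⁻¹ := inv_pos.2 htr
  let σ : BipartiteOp c d := ((τ.trace.re⁻¹ : ℝ) : ℂ) • τ
  have hσ : IsState σ := by
    refine ⟨hτ.smul (by exact_mod_cast hc.le), ?_⟩
    rw [Matrix.trace_smul, hre, smul_eq_mul, Complex.ofReal_re, ← Complex.ofReal_mul,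
      inv_mul_cancel₀ htr.ne', Complex.ofReal_one]
  have hmix := isCopyCorrelatedUndistillable_mix hσ (hτu.smul hc.le) hk (e.symm (x, 0))
    (f.symm (y, 0))
  refine ⟨_, hmix, half_lt_singletFraction_two (tensor_posSemidef hρ.1.1 hmix.1.1)
    (contraction e) (contraction f) ?_⟩
  have hk1 : ((k : ℂ) - 1) = ((k - 1 : ℝ) : ℂ) := by push_cast; rfl
  rw [hk1, ← Complex.ofReal_inv]
  simp only [σ, tensor_smul, tensor_add, Matrix.mul_smul, Matrix.smul_mul, Matrix.mul_add,
    Matrix.add_mul, excess_smul, excess_add, excess_contraction_single, mul_zero, add_zero]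
  have : (0 : ℝ) < k := by exact_mod_cast hk
  positivity

end Activation

end CopyCorrelated

theorem mainTheorem7 {a b : Type*} [Fintype a] [DecidableEq a] [Fintype b] [DecidableEq b]
    (ρ : CopyCorrelated.BipartiteOp a b) (hρ : CopyCorrelated.IsEntangled ρ)
    (k : ℕ) (hk : 1 ≤ k) :
    ∃ (m n : ℕ) (σ : CopyCorrelated.BipartiteOp (Fin m) (Fin n)),
      CopyCorrelated.IsCopyCorrelatedUndistillable k σ ∧
        1 / 2 < CopyCorrelated.singletFraction 2 (CopyCorrelated.tensor ρ σ) :=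
  ⟨_, _, CopyCorrelated.exists_isCopyCorrelatedUndistillable_half_lt hρ hk
    (Fintype.equivFin (a × Fin 2)).symm (Fintype.equivFin (b × Fin 2)).symm⟩
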